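/- Let $\mathcal L^{-1}(0)\subset\mathbb C^8$ be given by $$|z_1|^2+|z_5|^2=6,\quad |z_2|^2+|z_5|^2+|z_7|^2=10,\quad |z_3|^2+|z_7|^2=6,$$ $$|z_4|^2-|z_5|^2+|z_7|^2=4,\quad |z_5|^2-|z_6|^2+|z_7|^2=2,\quad |z_5|^2-|z_7|^2+|z_8|^2=4,$$ let $\mathbb T^6$ act on $\mathbb C^8$ with the coefficients of these six equations as weights (the $i$-th circle rotates $z_k$ with the weight with which $|z_k|^2$ enters the $i$-th equation), and let $(M,\omega)$, $M=\mathcal L^{-1}(0)/\mathbb T^6$, be the symplectic quotient, a symplectic $4$-manifold whose form is induced by $\omega_{st}=\frac i2\sum_j dz_j\wedge d\bar z_j$. For $t=(t_1,t_2,t_3,t_4)\in\mathbb R^4$ define on $M$ $$J=\tfrac12|z_1|^2,\qquad H_t=(1-2t_1)\tfrac12|z_3|^2+\tfrac{t_1}{50}\,\mathrm{Re}(\overline{z_2z_3z_4}\,z_6z_7z_8)+\tfrac{t_2}{50}|z_5|^4|z_4|^4+\tfrac{t_3}{50}|z_4|^4|z_7|^4+\tfrac{t_4}{100}|z_5|^4|z_7|^4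 .$$ For $k\in\{2,3,6,7\}$ let $\varphi_k$ be the map into $M$, defined near $(0,0)\in\mathbb C^2$, which sends $(x+iy,u+iv)$ to the class of the point of $\mathcal L^{-1}(0)$ with $z_k=x+iy$, $z_{k+1}=u+iv$ and all other coordinates positive real. It is a local parametrization of $M$, and $$\varphi_2(0,0)=[\sqrt2,0,0,\sqrt2,2,2\sqrt2,\sqrt6,\sqrt6],\quad \varphi_3(0,0)=[2,\sqrt2,0,0,\sqrt2,\sqrt6,\sqrt6,2\sqrt2],$$ $$\varphi_6(0,0)=[2,2\sqrt2,\sqrt6,\sqrt6,\sqrt2,0,0,\sqrt2],\quad \varphi_7(0,0)=[\sqrt2,\sqrt6,\sqrt6,2\sqrt2,2,\sqrt2,0,0].$$ A fixed point $p$ of $(J,H_t)$ (that is, $dJ(p)=dH_t(p)=0$) is non-degenerate if $d^2J(p)$ and $d^2H_t(p)$ are linearly independent and some linear combination of $\omega_p^{-1}d^2J(p)$ and $\omega_p^{-1}d^2H_t(p)$ has four distinct complex eigenvalues. Then for every $t\in\mathbb R^4$ and every $k\in\{2,3,6,7\}$ the point $p=\varphi_k(0,0)$ is a fixed point of $(J,H_t)$,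 and for all $c_1,c_2\in\mathbb R$ (and with respect to the coordinates of any local parametrization of $M$ around $p$) $$\det\bigl(\omega_p^{-1}(c_1\,d^2J(p)+c_2\,d^2H_t(p))\bigr)=\frac{f_k(t_1,t_2,t_3,t_4,c_1,c_2)^2}{390625}\ \ge 0,$$ where \begin{align*} f_2&=625c_1^2+25c_1c_2(-25+50t_1-256t_2-384t_3-192t_4)+48c_2^2\bigl(3t_1^2+320t_2^2+75t_3+720t_3^2+75t_4+864t_3t_4\\ &\qquad+144t_4^2+t_2(50+960t_3+576t_4)-50t_1(2t_2+3(t_3+t_4))\bigr),\\ f_3&=625c_1^2-25c_1c_2(-25+50t_1+168t_4)+72c_2^2\bigl(2t_1^2+50t_1t_4+t_4(-25+96t_4)\bigr),\\ f_6&=625c_1^2+25c_1c_2(-25+50t_1-432t_2)+48c_2^2\bigl(3t_1^2-200t_1t_2+20t_2(5+48t_2)\bigr),\\ f_7&=625c_1^2-125c_1c_2(-5+10t_1+256t_2)+48c_2^2\bigl(3t_1^2+800t_1t_2+16t_2(-25+512t_2)\bigr). \end{align*} Moreover, $p$ is never of hyperbolic-elliptic type. That is, $p$ is never a non-degenerate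 fixed point of $(J,H_t)$ for which one of the following holds: (a) for some $c_1,c_2\in\mathbb R$ the set of eigenvalues of $\omega_p^{-1}(c_1d^2J(p)+c_2d^2H_t(p))$ is $\{i\alpha,-i\alpha,\beta,-\beta\}$ with real $\alpha,\beta\ne0$; (b) there are local symplectic coordinates $(x_1,x_2,\xi_1,\xi_2)$ centred at $p$ in which $J$ and $H_t$ both Poisson commute, near $p$, with $(x_1^2+\xi_1^2)/2$ and with $x_2\xi_2$. -/

import Mathlib

noncomputable section

namespace Octagon

/-! The octagon manifold `M = 𝓛⁻¹(0) / 𝕋⁶`. Coordinates `z₁, …, z₈` of `ℂ⁸` are indexed by `Fin 8`,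
so `z_k` is `z (k - 1)`; likewise `t_j` is `t (j - 1)`. -/

/-- The integer weights of the six manifold equations. Row `i` is also the weight vector by which
the `i`-th circle factor of `𝕋⁶` acts on `ℂ⁸`. -/
def weight : Matrix (Fin 6) (Fin 8) ℤ :=
  !![1, 0, 0, 0,  1,  0,  0, 0;
     0, 1, 0, 0,  1,  0,  1, 0;
     0, 0, 1, 0,  0,  0,  1, 0;
     0, 0, 0, 1, -1,  0,  1, 0;
     0, 0, 0, 0,  1, -1,  1, 0;
     0, 0, 0, 0,  1,  0, -1, 1]

/-- The constants of the six manifold equations. -/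
def level : Fin 6 → ℝ := ![6, 10, 6, 4, 2, 4]

/-- The momentum map of the `𝕋⁶`-action on `ℂ⁸`. -/
def momentum (z : Fin 8 → ℂ) (i : Fin 6) : ℝ :=
  -(1 / 2) * ((∑ k, (weight i k : ℝ) * ‖z k‖ ^ 2) - level i)

/-- The zero level set of the momentum map. -/
def LevelSet : Type := {z : Fin 8 → ℂ // ∀ i, momentum z i = 0}

/-- The coordinates in `ℂ⁸` of a point of the level set. -/
def LevelSet.val (z : LevelSet) : Fin 8 → ℂ := z.1

/-- The factor by which `θ ∈ 𝕋⁶` multiplies the coordinate `z_k`. -/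
def phase (θ : Fin 6 → Circle) (k : Fin 8) : Circle := ∏ i, θ i ^ weight i k

/-- Two points of the level set are equivalent if they lie in the same `𝕋⁶`-orbit. -/
def torusSetoid : Setoid LevelSet where
  r z w := ∃ θ : Fin 6 → Circle, ∀ k, w.val k = (phase θ k : ℂ) * z.val k
  iseqv :=
    { refl := fun z => ⟨1, fun k => by simp [phase]⟩
      symm := by
        rintro z w ⟨θ, h⟩
        refine ⟨θ⁻¹, fun k => ?_⟩
        have : phase θ⁻¹ k * phase θ k = 1 := by
          simp [phase]
        rw [h k, ← mul_assoc, ← Circle.coe_mul, this, Circle.coe_one, one_mul]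
      trans := by
        rintro z w v ⟨θ, h⟩ ⟨η, g⟩
        refine ⟨η * θ, fun k => ?_⟩
        have : phase (η * θ) k = phase η k * phase θ k := by
          simp [phase, ← Finset.prod_mul_distrib, mul_zpow]
        rw [g k, h k, this, Circle.coe_mul, mul_assoc] }

/-- The symplectic quotient `M = 𝓛⁻¹(0) / 𝕋⁶`. -/
def M : Type := Quotient torusSetoid

/-- The quotient map `τ : 𝓛⁻¹(0) → M`, `z ↦ [z]`. -/
def toM (z : LevelSet) : M := Quotient.mk torusSetoid z

/-! The functions `J`, `H`, `γ₁, …, γ₄` and `H_t` on `M`. -/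

theorem norm_val_eq {z w : LevelSet} (h : torusSetoid.r z w) (k : Fin 8) :
    ‖z.val k‖ = ‖w.val k‖ := by
  obtain ⟨θ, h⟩ := h
  rw [h k, norm_mul, Circle.norm_coe, one_mul]

/-- `|z_{k+1}|` as a function on `M`. -/
def absCoord (k : Fin 8) : M → ℝ :=
  Quotient.lift (fun z : LevelSet => ‖z.val k‖) fun _ _ h => norm_val_eq h k

/-- The complex monomial `conj (z₂ z₃ z₄) z₆ z₇ z₈`. -/
def monomial (z : Fin 8 → ℂ) : ℂ :=
  starRingEnd ℂ (z 1 * z 2 * z 3) * z 5 * z 6 * z 7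

theorem phase_cancel (θ : Fin 6 → Circle) :
    (phase θ 1 * phase θ 2 * phase θ 3)⁻¹ * phase θ 5 * phase θ 6 * phase θ 7 = 1 := by
  simp only [phase, weight, Fin.prod_univ_six]
  simp [zpow_neg]
  have key : ∀ a b c d e : Circle,
      (a * b * c)⁻¹ * d⁻¹ * (a * b * c * d * e⁻¹) * e = 1 := by
    intro a b c d e
    apply Circle.ext
    have ha := a.coe_ne_zero
    have hb := b.coe_ne_zero
    have hc := c.coe_ne_zero
    have hd := d.coe_ne_zero
    have he := e.coe_ne_zero
    push_cast
    field_simp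
  have := key (θ 1) (θ 2) (θ 3) (θ 4) (θ 5)
  simpa using this

theorem monomial_eq {z w : LevelSet} (h : torusSetoid.r z w) :
    monomial z.val = monomial w.val := by
  obtain ⟨θ, h⟩ := h
  have hc := congrArg (fun c : Circle => (c : ℂ)) (phase_cancel θ)
  simp only [Circle.coe_mul, Circle.coe_inv_eq_conj, Circle.coe_one, map_mul] at hc
  simp only [monomial, h, map_mul]
  linear_combination (-(starRingEnd ℂ (z.val 1) * starRingEnd ℂ (z.val 2) *
    starRingEnd ℂ (z.val 3) * z.val 5 * z.val 6 * z.val 7)) * hc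

def J (p : M) : ℝ := absCoord 0 p ^ 2 / 2

def H (p : M) : ℝ := absCoord 2 p ^ 2 / 2

def γ₁ : M → ℝ :=
  Quotient.lift (fun z : LevelSet => 1 / 50 * (monomial z.val).re)
    fun _ _ h => congrArg (fun c : ℂ => 1 / 50 * c.re) (monomial_eq h)

def γ₂ (p : M) : ℝ := 1 / 50 * (absCoord 4 p ^ 4 * absCoord 3 p ^ 4)

def γ₃ (p : M) : ℝ := 1 / 50 * (absCoord 3 p ^ 4 * absCoord 6 p ^ 4)

def γ₄ (p : M) : ℝ := 1 / 100 * (absCoord 4 p ^ 4 * absCoord 6 p ^ 4)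

/-- `H_t = (1 - 2 t₁) H + t₁ γ₁ + t₂ γ₂ + t₃ γ₃ + t₄ γ₄`. -/
def Ht (t : Fin 4 → ℝ) (p : M) : ℝ :=
  (1 - 2 * t 0) * H p + t 0 * γ₁ p + t 1 * γ₂ p + t 2 * γ₃ p + t 3 * γ₄ p

/-! The smooth and symplectic structure of `M`. -/

/-- The standard symplectic form `(i/2) ∑ dz_k ∧ dz̄_k = ∑ dx_k ∧ dy_k` on `ℂ⁸`. -/
def stdForm (v w : Fin 8 → ℂ) : ℝ := ∑ k, ((v k).re * (w k).im - (v k).im * (w k).re)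

/-- The matrix at `x` of the pull-back of the standard form of `ℂ⁸` under a map `S` into the level
set. As the reduced form `ω` satisfies `τ^* ω = κ^* ω_st`, this is the matrix of `ω` with respect to
the vectors `∂_i (τ ∘ S)(x)`. -/
def formMatrix (S : (Fin 4 → ℝ) → LevelSet) (x : Fin 4 → ℝ) : Matrix (Fin 4) (Fin 4) ℝ :=
  Matrix.of fun i j =>
    stdForm (fderiv ℝ (fun y => (S y).val) x (Pi.single i 1))
      (fderiv ℝ (fun y => (S y).val) x (Pi.single j 1))

/-- `S` represents a local parametrization `τ ∘ S` of `M` that sends the origin to `p`: it is a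
smooth map into the level set near `0`, and the pull-back of `ω` at `0` is non-degenerate. As
`dim M = 4` and `ω` is non-degenerate, the latter says that the derivative of `τ ∘ S` at `0` is
invertible. As `τ` is a principal bundle, every local parametrization of the smooth manifold `M`
is of this form near the origin. Values of `S` away from the origin play no role. -/
def IsLocalParametrization (S : (Fin 4 → ℝ) → LevelSet) (p : M) : Prop :=
  toM (S 0) = p ∧
  (∃ U : Set (Fin 4 → ℝ), IsOpen U ∧ 0 ∈ U ∧
    ContDiffOn ℝ ((⊤ : ℕ∞) : WithTop ℕ∞) (fun x => (S x).val) U) ∧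
  IsUnit (formMatrix S 0).det

/-- A function on `M`, read in a local parametrization. -/
def inCoords (F : M → ℝ) (S : (Fin 4 → ℝ) → LevelSet) (x : Fin 4 → ℝ) : ℝ := F (toM (S x))

/-- The matrix of the Hessian of `F` at the origin of a local parametrization. -/
def hessian (F : M → ℝ) (S : (Fin 4 → ℝ) → LevelSet) : Matrix (Fin 4) (Fin 4) ℝ :=
  Matrix.of fun i j =>
    fderiv ℝ (fun x => fderiv ℝ (inCoords F S) x (Pi.single j 1)) 0 (Pi.single i 1)

/-- The matrix `ω_p⁻¹ (c₁ d²F₁(p) + c₂ d²F₂(p))` in the local parametrization `S`. -/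
def linearization (F₁ F₂ : M → ℝ) (S : (Fin 4 → ℝ) → LevelSet) (c₁ c₂ : ℝ) :
    Matrix (Fin 4) (Fin 4) ℝ :=
  (formMatrix S 0)⁻¹ * (c₁ • hessian F₁ S + c₂ • hessian F₂ S)

/-! Singular points of rank zero and their types. -/

/-- `p` is a fixed point (singular point of rank zero) of `(F₁, F₂)`: both differentials vanish. -/
def IsFixedPoint (F₁ F₂ : M → ℝ) (p : M) : Prop :=
  ∀ S, IsLocalParametrization S p →
    HasFDerivAt (inCoords F₁ S) (0 : (Fin 4 → ℝ) →L[ℝ] ℝ) 0 ∧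
    HasFDerivAt (inCoords F₂ S) (0 : (Fin 4 → ℝ) →L[ℝ] ℝ) 0

/-- Non-degenerate fixed points: the Hessians are linearly independent and some linear combination
of `ω_p⁻¹ d²F₁(p)` and `ω_p⁻¹ d²F₂(p)` has four distinct (complex) eigenvalues. -/
def IsNondegenerateFixedPoint (F₁ F₂ : M → ℝ) (p : M) : Prop :=
  IsFixedPoint F₁ F₂ p ∧
  ∃ S, IsLocalParametrization S p ∧
    LinearIndependent ℝ ![hessian F₁ S, hessian F₂ S] ∧
    ∃ c₁ c₂ : ℝ, (spectrum ℂ ((linearization F₁ F₂ S c₁ c₂).map Complex.ofReal)).ncard = 4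

/-- Hyperbolic-elliptic fixed points, by eigenvalues: `p` is non-degenerate, and some linear
combination has the four distinct eigenvalues `± i α`, `± β` with `α, β` real and non-zero. -/
def IsHyperbolicElliptic (F₁ F₂ : M → ℝ) (p : M) : Prop :=
  IsNondegenerateFixedPoint F₁ F₂ p ∧
  ∃ S, IsLocalParametrization S p ∧
    ∃ c₁ c₂ α β : ℝ, α ≠ 0 ∧ β ≠ 0 ∧
      spectrum ℂ ((linearization F₁ F₂ S c₁ c₂).map Complex.ofReal) =
        {Complex.I * α, -(Complex.I * α), (β : ℂ), -(β : ℂ)}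

/-- The matrix of `dx₁ ∧ dξ₁ + dx₂ ∧ dξ₂` in coordinates `(x₁, x₂, ξ₁, ξ₂)`. -/
def canonicalForm : Matrix (Fin 4) (Fin 4) ℝ :=
  !![0, 0, 1, 0; 0, 0, 0, 1; -1, 0, 0, 0; 0, -1, 0, 0]

/-- The Poisson bracket at `x` in canonical coordinates `(x₁, x₂, ξ₁, ξ₂)`. -/
def poisson (g h : (Fin 4 → ℝ) → ℝ) (x : Fin 4 → ℝ) : ℝ :=
  let d (f : (Fin 4 → ℝ) → ℝ) (i : Fin 4) : ℝ := fderiv ℝ f x (Pi.single i 1)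
  d g 0 * d h 2 - d g 2 * d h 0 + (d g 1 * d h 3 - d g 3 * d h 1)

/-- Hyperbolic-elliptic fixed points, by Williamson type `(n_E, n_H, n_FF) = (1, 1, 0)`: `p` is
non-degenerate, and there are local symplectic coordinates `(x₁, x₂, ξ₁, ξ₂)` centred at `p` in
which `F₁` and `F₂` Poisson commute with the elliptic component `q₁ = (x₁² + ξ₁²) / 2` and with the
hyperbolic component `q₂ = x₂ ξ₂`. -/
def HasHyperbolicEllipticNormalForm (F₁ F₂ : M → ℝ) (p : M) : Prop :=
  IsNondegenerateFixedPoint F₁ F₂ p ∧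
  ∃ S, IsLocalParametrization S p ∧
    ∀ᶠ x in nhds (0 : Fin 4 → ℝ), formMatrix S x = canonicalForm ∧
      ∀ F ∈ ({F₁, F₂} : Set (M → ℝ)),
        poisson (fun y => (y 0 ^ 2 + y 2 ^ 2) / 2) (inCoords F S) x = 0 ∧
        poisson (fun y => y 1 * y 3) (inCoords F S) x = 0

/-! The four invariant points and the charts around them. -/

/-- The labels `2, 3, 6, 7` of the four charts that contain the invariant points. -/
inductive Label
  | two
  | three
  | six
  | seven

/-- The (zero-based) position `ν - 1` of the coordinate `z_ν` that is free in the chart `φ_ν`; the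
coordinate `z_{ν+1}` in the next position is free as well. -/
def Label.pos : Label → Fin 8
  | two => 1
  | three => 2
  | six => 5
  | seven => 6

/-- The values of `|z₁|², …, |z₈|²` in the chart `φ_ν` in terms of `a = |z_ν|²`, `b = |z_{ν+1}|²`,
obtained by solving the manifold equations. -/
def Label.sq : Label → ℝ → ℝ → Fin 8 → ℝ
  | two, a, b =>
    ![2 + a - b, a, b, 2 - a + 2 * b, 4 - a + b, 8 - a, 6 - b, 6 + a - 2 * b]
  | three, a, b =>
    ![4 + a - b, 2 + 2 * a - b, a, b, 2 - a + b, 6 - 2 * a + b, 6 - a, 8 - b]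
  | six, a, b =>
    ![4 - a + b, 8 - a, 6 - b, 6 + a - 2 * b, 2 + a - b, a, b, 2 - a + 2 * b]
  | seven, a, b =>
    ![2 - a + b, 6 - 2 * a + b, 6 - a, 8 - b, 4 + a - b, 2 + 2 * a - b, a, b]

/-- The invariant points `φ_2(0,0)`, `φ_3(0,0)`, `φ_6(0,0)`, `φ_7(0,0)`, as points of `ℂ⁸`. -/
def Label.vec : Label → Fin 8 → ℂ
  | two => fun i => ((![√2, 0, 0, √2, 2, 2 * √2, √6, √6] : Fin 8 → ℝ) i : ℂ)
  | three => fun i => ((![2, √2, 0, 0, √2, √6, √6, 2 * √2] : Fin 8 → ℝ) i : ℂ)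
  | six => fun i => ((![2, 2 * √2, √6, √6, √2, 0, 0, √2] : Fin 8 → ℝ) i : ℂ)
  | seven => fun i => ((![√2, √6, √6, 2 * √2, 2, √2, 0, 0] : Fin 8 → ℝ) i : ℂ)

theorem Label.vec_mem (k : Label) : ∀ i, momentum k.vec i = 0 := by
  intro i
  cases k <;> fin_cases i <;>
    simp [momentum, Label.vec, weight, level, Fin.sum_univ_eight, mul_pow] <;> norm_num

/-- The invariant points, as points of the level set. -/
def Label.rep (k : Label) : LevelSet := ⟨k.vec, k.vec_mem⟩

/-- The invariant points of `M`. -/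
def invariantPoint (k : Label) : M := toM k.rep

/-- The chart `φ_ν(x + i y, u + i v)` as a vector in `ℂ⁸`: the entries `ν` and `ν + 1` are `x + i y`
and `u + i v`, the others are the positive roots of the manifold equations. Here
`(x, y, u, v) = (x 0, x 1, x 2, x 3)`. -/
def chartVec (k : Label) (x : Fin 4 → ℝ) (i : Fin 8) : ℂ :=
  if i = k.pos then ⟨x 0, x 1⟩
  else if i = k.pos + 1 then ⟨x 2, x 3⟩
  else (√(k.sq (x 0 ^ 2 + x 1 ^ 2) (x 2 ^ 2 + x 3 ^ 2) i) : ℝ)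

/-- The domain of the chart `φ_ν`: the radicands are positive. -/
def chartDomain (k : Label) : Set (Fin 4 → ℝ) :=
  {x | ∀ i, i ≠ k.pos → i ≠ k.pos + 1 →
    0 < k.sq (x 0 ^ 2 + x 1 ^ 2) (x 2 ^ 2 + x 3 ^ 2) i}

theorem chartVec_mem (k : Label) (x : Fin 4 → ℝ) (hx : x ∈ chartDomain k) :
    ∀ i, momentum (chartVec k x) i = 0 := by
  have h : ∀ i, ‖chartVec k x i‖ ^ 2 = k.sq (x 0 ^ 2 + x 1 ^ 2) (x 2 ^ 2 + x 3 ^ 2) i := by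
    intro i
    unfold chartVec
    split_ifs with h1 h2
    · rw [← Complex.normSq_eq_norm_sq, Complex.normSq_mk, h1]
      cases k <;> simp [Label.sq, Label.pos] <;> ring
    · rw [← Complex.normSq_eq_norm_sq, Complex.normSq_mk, h2]
      cases k <;> simp [Label.sq, Label.pos] <;> ring
    · rw [Complex.norm_real, Real.norm_eq_abs, sq_abs, Real.sq_sqrt (hx i h1 h2).le]
  intro i
  simp only [momentum, h]
  cases k <;> fin_cases i <;>
    simp [Label.sq, weight, level, Fin.sum_univ_eight] <;> ring

open Classical in
/-- The chart `φ_ν`, as a map into the level set (with a constant value off its domain). -/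
def chart (k : Label) (x : Fin 4 → ℝ) : LevelSet :=
  if hx : x ∈ chartDomain k then ⟨chartVec k x, chartVec_mem k x hx⟩ else k.rep

/-- The polynomials `f_k(t₁, t₂, t₃, t₄, c₁, c₂)`. -/
def Label.poly : Label → (t₁ t₂ t₃ t₄ c₁ c₂ : ℝ) → ℝ
  | two, t₁, t₂, t₃, t₄, c₁, c₂ =>
    625 * c₁ ^ 2 + 25 * c₁ * c₂ * (-25 + 50 * t₁ - 256 * t₂ - 384 * t₃ - 192 * t₄)
      + 48 * c₂ ^ 2 * (3 * t₁ ^ 2 + 320 * t₂ ^ 2 + 75 * t₃ + 720 * t₃ ^ 2 + 75 * t₄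
        + 864 * t₃ * t₄ + 144 * t₄ ^ 2 + t₂ * (50 + 960 * t₃ + 576 * t₄)
        - 50 * t₁ * (2 * t₂ + 3 * (t₃ + t₄)))
  | three, t₁, _, _, t₄, c₁, c₂ =>
    625 * c₁ ^ 2 - 25 * c₁ * c₂ * (-25 + 50 * t₁ + 168 * t₄)
      + 72 * c₂ ^ 2 * (2 * t₁ ^ 2 + 50 * t₁ * t₄ + t₄ * (-25 + 96 * t₄))
  | six, t₁, t₂, _, _, c₁, c₂ =>
    625 * c₁ ^ 2 + 25 * c₁ * c₂ * (-25 + 50 * t₁ - 432 * t₂)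
      + 48 * c₂ ^ 2 * (3 * t₁ ^ 2 - 200 * t₁ * t₂ + 20 * t₂ * (5 + 48 * t₂))
  | seven, t₁, t₂, _, _, c₁, c₂ =>
    625 * c₁ ^ 2 - 125 * c₁ * c₂ * (-5 + 10 * t₁ + 256 * t₂)
      + 48 * c₂ ^ 2 * (3 * t₁ ^ 2 + 800 * t₁ * t₂ + 16 * t₂ * (-25 + 512 * t₂))

end Octagon

end

namespace Octagon

/-! At an invariant point exactly two coordinates `z_k`, `z_{k+1}` vanish. On the level set every
`|z_i|²` is affine in `|z_k|²` and `|z_{k+1}|²` (`sq_norm_eq`), and the monomial in `γ₁` is, up to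
conjugation, `z_k z_{k+1}` times a cofactor of modulus 24 at the point. So `J` and `H_t` are
critical there, and in the free coordinates their Hessians have the form `quadMatrix α β p q`. This
is a form `α|z|²/2 + β|w|²/2 + Re(c z w)`, Hermitian in `(z, w̄)`, so its real determinant is the
square of the 2×2 Hermitian determinant `αβ - |c|²`.

For an arbitrary local parametrization, let `L` be the Jacobian of the free coordinates. The
Hessians are `Lᵀ Q L` (`hasJet_J`, `hasJet_Ht`) and the symplectic matrix is `Lᵀ Ω L`
(`IsCenteredAt.formMatrix_eq`). Hence `L` cancels in the determinant of the linearization, which is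
a square (`linearization_det`).

Type (a) is excluded because eigenvalues `±iα, ±β` have product `-α²β² < 0` (`det_neg_of_spectrum`).
Type (b) is excluded because a Hessian commuting with both normal-form components has determinant at
most 0 (`det_nonpos_of_poisson`), whereas for `J` this determinant would be 1. -/

/-! ### Second-order calculus at a critical point -/

/-- The matrix of second derivatives at the origin. -/
noncomputable def secondDeriv (F : (Fin 4 → ℝ) → ℝ) : Matrix (Fin 4) (Fin 4) ℝ :=
  Matrix.of fun i j => fderiv ℝ (fun x => fderiv ℝ F x (Pi.single j 1)) 0 (Pi.single i 1)

theorem eventually_differentiableAt {F : (Fin 4 → ℝ) → ℝ} (hF : ContDiffAt ℝ 2 F 0) :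
    ∀ᶠ x in nhds (0 : Fin 4 → ℝ), DifferentiableAt ℝ F x :=
  (hF.eventually (by simp)).mono fun _ hx => hx.differentiableAt (by simp)

theorem differentiableAt_fderiv_apply {F : (Fin 4 → ℝ) → ℝ} (hF : ContDiffAt ℝ 2 F 0)
    (v : Fin 4 → ℝ) : DifferentiableAt ℝ (fun x => fderiv ℝ F x v) 0 :=
  ((hF.fderiv_right (m := 1) (by norm_num)).differentiableAt (by simp)).clm_apply
    (differentiableAt_const v)

theorem secondDeriv_add {F G : (Fin 4 → ℝ) → ℝ} (hF : ContDiffAt ℝ 2 F 0)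
    (hG : ContDiffAt ℝ 2 G 0) :
    secondDeriv (fun x => F x + G x) = secondDeriv F + secondDeriv G := by
  ext i j
  have : (fun x => fderiv ℝ (fun x => F x + G x) x (Pi.single j 1)) =ᶠ[nhds 0]
      fun x => fderiv ℝ F x (Pi.single j 1) + fderiv ℝ G x (Pi.single j 1) := by
    filter_upwards [eventually_differentiableAt hF, eventually_differentiableAt hG] with x h1 h2
    rw [fderiv_fun_add h1 h2, add_apply]
  simp only [secondDeriv, Matrix.of_apply, Matrix.add_apply, this.fderiv_eq]
  rw [fderiv_fun_add (differentiableAt_fderiv_apply hF _) (differentiableAt_fderiv_apply hG _),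
    add_apply]

theorem secondDeriv_mul {F G : (Fin 4 → ℝ) → ℝ} (hF : ContDiffAt ℝ 2 F 0)
    (hG : ContDiffAt ℝ 2 G 0) (i j : Fin 4) :
    secondDeriv (fun x => F x * G x) i j =
      F 0 * secondDeriv G i j + G 0 * secondDeriv F i j
        + fderiv ℝ F 0 (Pi.single i 1) * fderiv ℝ G 0 (Pi.single j 1)
        + fderiv ℝ F 0 (Pi.single j 1) * fderiv ℝ G 0 (Pi.single i 1) := by
  have : (fun x => fderiv ℝ (fun x => F x * G x) x (Pi.single j 1)) =ᶠ[nhds 0]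
      fun x => F x * fderiv ℝ G x (Pi.single j 1) + G x * fderiv ℝ F x (Pi.single j 1) := by
    filter_upwards [eventually_differentiableAt hF, eventually_differentiableAt hG] with x h1 h2
    rw [fderiv_fun_mul h1 h2]
    simp
  simp only [secondDeriv, Matrix.of_apply, this.fderiv_eq]
  have dF := hF.differentiableAt (by simp)
  have dG := hG.differentiableAt (by simp)
  have dF' := differentiableAt_fderiv_apply hF (Pi.single j 1)
  have dG' := differentiableAt_fderiv_apply hG (Pi.single j 1)
  rw [fderiv_fun_add (dF.fun_mul dG') (dG.fun_mul dF'), fderiv_fun_mul dF dG', fderiv_fun_mul dG dF']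
  simp only [add_apply, smul_apply, smul_eq_mul]
  ring

theorem secondDeriv_const (c : ℝ) : secondDeriv (fun _ => c) = 0 := by
  ext i j
  simp [secondDeriv]

/-- The origin is a critical point of `F`, with critical value `c` and Hessian `h`. -/
structure IsCriticalJet (F : (Fin 4 → ℝ) → ℝ) (c : ℝ) (h : Matrix (Fin 4) (Fin 4) ℝ) : Prop where
  contDiffAt : ContDiffAt ℝ 2 F 0
  value : F 0 = c
  fderiv_eq : fderiv ℝ F 0 = 0
  hess : secondDeriv F = h

namespace IsCriticalJet

variable {F G : (Fin 4 → ℝ) → ℝ} {c d : ℝ} {h h' : Matrix (Fin 4) (Fin 4) ℝ}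

theorem hasFDerivAt (hF : IsCriticalJet F c h) :
    HasFDerivAt F (0 : (Fin 4 → ℝ) →L[ℝ] ℝ) 0 :=
  hF.fderiv_eq ▸ (hF.contDiffAt.differentiableAt (by simp)).hasFDerivAt

theorem const (c : ℝ) : IsCriticalJet (fun _ => c) c 0 :=
  ⟨contDiffAt_const, rfl, by simp, secondDeriv_const c⟩

theorem add (hF : IsCriticalJet F c h) (hG : IsCriticalJet G d h') :
    IsCriticalJet (fun x => F x + G x) (c + d) (h + h') where
  contDiffAt := hF.contDiffAt.add hG.contDiffAt
  value := by rw [hF.value, hG.value]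
  fderiv_eq := by
    rw [fderiv_fun_add hF.hasFDerivAt.differentiableAt hG.hasFDerivAt.differentiableAt,
      hF.fderiv_eq, hG.fderiv_eq, add_zero]
  hess := by rw [secondDeriv_add hF.contDiffAt hG.contDiffAt, hF.hess, hG.hess]

theorem mul (hF : IsCriticalJet F c h) (hG : IsCriticalJet G d h') :
    IsCriticalJet (fun x => F x * G x) (c * d) (c • h' + d • h) where
  contDiffAt := hF.contDiffAt.mul hG.contDiffAt
  value := by rw [hF.value, hG.value]
  fderiv_eq := by
    rw [fderiv_fun_mul hF.hasFDerivAt.differentiableAt hG.hasFDerivAt.differentiableAt,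
      hF.fderiv_eq, hG.fderiv_eq]
    simp
  hess := by
    ext i j
    rw [secondDeriv_mul hF.contDiffAt hG.contDiffAt, hF.hess, hG.hess, hF.value, hG.value,
      hF.fderiv_eq, hG.fderiv_eq]
    simp

/-- Since `F` vanishes to second order, the first and second derivatives of `G` drop out, so `G`
need not be critical. This is needed for the cofactor of the monomial. -/
theorem mul_contDiffAt (hF : IsCriticalJet F 0 h) (hG : ContDiffAt ℝ 2 G 0) :
    IsCriticalJet (fun x => F x * G x) 0 (G 0 • h) where
  contDiffAt := hF.contDiffAt.mul hG
  value := by rw [hF.value, zero_mul]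
  fderiv_eq := by
    rw [fderiv_fun_mul hF.hasFDerivAt.differentiableAt (hG.differentiableAt (by simp)),
      hF.fderiv_eq, hF.value]
    simp
  hess := by
    ext i j
    rw [secondDeriv_mul hF.contDiffAt hG, hF.hess, hF.value, hF.fderiv_eq]
    simp

theorem mul_of_eq_zero (hF : ContDiffAt ℝ 2 F 0) (hG : ContDiffAt ℝ 2 G 0) (hF0 : F 0 = 0)
    (hG0 : G 0 = 0) :
    IsCriticalJet (fun x => F x * G x) 0 (Matrix.of fun i j =>
      fderiv ℝ F 0 (Pi.single i 1) * fderiv ℝ G 0 (Pi.single j 1)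
        + fderiv ℝ F 0 (Pi.single j 1) * fderiv ℝ G 0 (Pi.single i 1)) where
  contDiffAt := hF.mul hG
  value := by rw [hF0, zero_mul]
  fderiv_eq := by
    rw [fderiv_fun_mul (hF.differentiableAt (by simp)) (hG.differentiableAt (by simp)), hF0, hG0]
    simp
  hess := by
    ext i j
    rw [secondDeriv_mul hF hG, hF0, hG0]
    simp

end IsCriticalJet

/-! ### Linear algebra of 4×4 matrices -/

/-- The Hessian matrix of `α (x² + y²) / 2 + β (u² + v²) / 2 + p (x u - y v) - q (x v + y u)`. -/
noncomputable def quadMatrix (α β p q : ℝ) : Matrix (Fin 4) (Fin 4) ℝ :=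
  !![α, 0, p, -q; 0, α, -q, -p; p, -q, β, 0; -q, -p, 0, β]

/-- The matrix of `dx ∧ dy + du ∧ dv`. -/
noncomputable def areaMatrix : Matrix (Fin 4) (Fin 4) ℝ :=
  !![0, 1, 0, 0; -1, 0, 0, 0; 0, 0, 0, 1; 0, 0, -1, 0]

theorem det_quadMatrix (α β p q : ℝ) :
    (quadMatrix α β p q).det = (α * β - (p ^ 2 + q ^ 2)) ^ 2 := by
  simp [quadMatrix, Matrix.det_succ_row_zero, Fin.sum_univ_succ, Fin.succAbove]
  ring

theorem det_areaMatrix : areaMatrix.det = 1 := by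
  simp [areaMatrix, Matrix.det_succ_row_zero, Fin.sum_univ_succ, Fin.succAbove]

theorem det_canonicalForm : canonicalForm.det = 1 := by
  simp [canonicalForm, Matrix.det_succ_row_zero, Fin.sum_univ_succ, Fin.succAbove]

theorem quadMatrix_add (α β p q α' β' p' q' : ℝ) :
    quadMatrix α β p q + quadMatrix α' β' p' q' =
      quadMatrix (α + α') (β + β') (p + p') (q + q') := by
  ext i j
  fin_cases i <;> fin_cases j <;> simp [quadMatrix] <;> ring

theorem smul_quadMatrix (r α β p q : ℝ) :
    r • quadMatrix α β p q = quadMatrix (r * α) (r * β) (r * p) (r * q) := by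
  ext i j
  fin_cases i <;> fin_cases j <;> simp [quadMatrix]

/-- Both factors scale by `(det L)²`, which cancels; this makes the result independent of the
parametrization. -/
theorem det_inv_congruence_mul (L Ω Q : Matrix (Fin 4) (Fin 4) ℝ) (hΩ : Ω.det = 1)
    (h : IsUnit (L.transpose * Ω * L).det) :
    ((L.transpose * Ω * L)⁻¹ * (L.transpose * Q * L)).det = Q.det := by
  have hL : L.det ≠ 0 := by
    rintro h0
    simp [Matrix.det_mul, h0] at h
  rw [Matrix.det_mul, Matrix.det_nonsing_inv]
  simp only [Matrix.det_mul, Matrix.det_transpose, hΩ, Ring.inverse_eq_inv']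
  field_simp

/-- A real matrix with spectrum `{± i α, ± β}`, `α, β ≠ 0`, has negative determinant. -/
theorem det_neg_of_spectrum (A : Matrix (Fin 4) (Fin 4) ℝ) {α β : ℝ} (hα : α ≠ 0) (hβ : β ≠ 0)
    (h : spectrum ℂ (A.map Complex.ofReal) =
      {Complex.I * α, -(Complex.I * α), (β : ℂ), -(β : ℂ)}) : A.det < 0 := by
  set B : Matrix (Fin 4) (Fin 4) ℂ := A.map Complex.ofReal with hB
  have hdet : B.det = (A.det : ℂ) := (RingHom.map_det Complex.ofRealHom A).symm
  let s : Multiset ℂ := {Complex.I * α, -(Complex.I * α), (β : ℂ), -(β : ℂ)}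
  have hs : s.Nodup := by
    simp only [s, Multiset.insert_eq_cons, Multiset.nodup_cons, Multiset.mem_cons,
      Multiset.mem_singleton, Multiset.nodup_singleton, Complex.ext_iff]
    simp [hα, hβ, eq_comm, self_eq_neg]
  -- The four values are distinct roots of a polynomial of degree four, so they are all its roots,
  -- each simple, and the determinant is their product.
  have hle : s ≤ B.charpoly.roots := by
    refine (Multiset.le_iff_subset hs).2 fun z hz => ?_
    rw [Polynomial.mem_roots (Matrix.charpoly_monic B).ne_zero,
      ← Matrix.mem_spectrum_iff_isRoot_charpoly, h]
    simpa [s] using hz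
  have hcard : B.charpoly.roots.card ≤ s.card := by
    refine (Polynomial.card_roots' _).trans ?_
    rw [Matrix.charpoly_natDegree_eq_dim]
    simp [s]
  have key := Matrix.det_eq_prod_roots_charpoly B
  rw [← Multiset.eq_of_le_of_card_le hle hcard, hdet] at key
  have : (A.det : ℂ) = ((-(α ^ 2 * β ^ 2) : ℝ) : ℂ) := by
    rw [key]
    simp only [s, Multiset.insert_eq_cons, Multiset.prod_cons, Multiset.prod_singleton]
    push_cast
    linear_combination (α ^ 2 * β ^ 2 : ℂ) * Complex.I_sq
  rw [Complex.ofReal_inj.1 this]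
  have : 0 < α ^ 2 * β ^ 2 := by positivity
  linarith

/-! ### Free coordinates and jets expressed in them -/

/-- The manifold equations are six linear equations in the eight squared moduli; the two free ones
determine the rest. -/
theorem sq_norm_eq (k : Label) (z : LevelSet) (i : Fin 8) :
    ‖z.val i‖ ^ 2 = k.sq (‖z.val k.pos‖ ^ 2) (‖z.val (k.pos + 1)‖ ^ 2) i := by
  have h : ∀ i, momentum z.val i = 0 := z.2
  have h0 := h 0
  have h1 := h 1
  have h2 := h 2
  have h3 := h 3
  have h4 := h 4
  have h5 := h 5
  simp [momentum, weight, level, Fin.sum_univ_eight] at h0 h1 h2 h3 h4 h5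
  cases k <;> fin_cases i <;> simp [Label.sq, Label.pos] <;> linarith

theorem sq_eq_affine (k : Label) (a b : ℝ) (i : Fin 8) :
    k.sq a b i = k.sq 0 0 i + a * (k.sq 1 0 i - k.sq 0 0 i) + b * (k.sq 0 1 i - k.sq 0 0 i) := by
  cases k <;> fin_cases i <;> simp [Label.sq] <;> ring

/-- The real coordinates `(x, y, u, v)` with `z_k = x + i y`, `z_{k+1} = u + i v`. -/
noncomputable def freeCoord (k : Label) (z : Fin 8 → ℂ) : Fin 4 → ℝ :=
  ![(z k.pos).re, (z k.pos).im, (z (k.pos + 1)).re, (z (k.pos + 1)).im]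

/-- The Jacobian matrix at the origin of the coordinates `(x, y, u, v)` along `S`. -/
noncomputable def jacobian (k : Label) (S : (Fin 4 → ℝ) → LevelSet) : Matrix (Fin 4) (Fin 4) ℝ :=
  Matrix.of fun m i => fderiv ℝ (fun x => freeCoord k (S x).val m) 0 (Pi.single i 1)

/-- `S` is smooth at the origin and maps it to the common zero set of `z_k` and `z_{k+1}`. -/
structure IsCenteredAt (k : Label) (S : (Fin 4 → ℝ) → LevelSet) : Prop where
  contDiffAt : ContDiffAt ℝ 2 (fun x => (S x).val) 0
  fst_eq_zero : (S 0).val k.pos = 0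
  snd_eq_zero : (S 0).val (k.pos + 1) = 0

namespace IsCenteredAt

variable {k : Label} {S : (Fin 4 → ℝ) → LevelSet}

theorem contDiffAt_apply (hS : IsCenteredAt k S) (i : Fin 8) :
    ContDiffAt ℝ 2 (fun x => (S x).val i) 0 :=
  contDiffAt_pi.1 hS.contDiffAt i

theorem contDiffAt_re (hS : IsCenteredAt k S) (i : Fin 8) :
    ContDiffAt ℝ 2 (fun x => ((S x).val i).re) 0 :=
  Complex.reCLM.contDiff.contDiffAt.comp 0 (hS.contDiffAt_apply i)

theorem contDiffAt_im (hS : IsCenteredAt k S) (i : Fin 8) :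
    ContDiffAt ℝ 2 (fun x => ((S x).val i).im) 0 :=
  Complex.imCLM.contDiff.contDiffAt.comp 0 (hS.contDiffAt_apply i)

theorem isCriticalJet_mul (hS : IsCenteredAt k S) (m n : Fin 4) :
    IsCriticalJet (fun x => freeCoord k (S x).val m * freeCoord k (S x).val n) 0
      (Matrix.of fun i j => jacobian k S m i * jacobian k S n j
        + jacobian k S m j * jacobian k S n i) := by
  have h (m : Fin 4) : ContDiffAt ℝ 2 (fun x => freeCoord k (S x).val m) 0 := by
    fin_cases m
    · exact hS.contDiffAt_re _
    · exact hS.contDiffAt_im _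
    · exact hS.contDiffAt_re _
    · exact hS.contDiffAt_im _
  have h0 (m : Fin 4) : freeCoord k (S 0).val m = 0 := by
    fin_cases m <;> simp [freeCoord, hS.fst_eq_zero, hS.snd_eq_zero]
  exact IsCriticalJet.mul_of_eq_zero (h m) (h n) (h0 m) (h0 n)

end IsCenteredAt

/-- The origin is critical for `F`, with value `c` and Hessian `quadMatrix α β p q` in the
coordinates `(x, y, u, v)`. -/
def HasJet (k : Label) (S : (Fin 4 → ℝ) → LevelSet) (F : (Fin 4 → ℝ) → ℝ) (c α β p q : ℝ) : Prop :=
  IsCriticalJet F c ((jacobian k S).transpose * quadMatrix α β p q * jacobian k S)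

namespace HasJet

variable {k : Label} {S : (Fin 4 → ℝ) → LevelSet} {F G : (Fin 4 → ℝ) → ℝ}
  {c α β p q c' α' β' p' q' : ℝ}

theorem const (c : ℝ) : HasJet k S (fun _ => c) c 0 0 0 0 := by
  have : quadMatrix 0 0 0 0 = 0 := by
    ext i j
    fin_cases i <;> fin_cases j <;> simp [quadMatrix]
  simpa [HasJet, this] using IsCriticalJet.const c

theorem add (hF : HasJet k S F c α β p q) (hG : HasJet k S G c' α' β' p' q') :
    HasJet k S (fun x => F x + G x) (c + c') (α + α') (β + β') (p + p') (q + q') := by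
  rw [HasJet, ← quadMatrix_add, Matrix.mul_add, Matrix.add_mul]
  exact IsCriticalJet.add hF hG

theorem mul (hF : HasJet k S F c α β p q) (hG : HasJet k S G c' α' β' p' q') :
    HasJet k S (fun x => F x * G x) (c * c') (c * α' + c' * α) (c * β' + c' * β)
      (c * p' + c' * p) (c * q' + c' * q) := by
  rw [HasJet, ← quadMatrix_add, ← smul_quadMatrix, ← smul_quadMatrix, Matrix.mul_add,
    Matrix.add_mul, Matrix.mul_smul, Matrix.mul_smul, Matrix.smul_mul, Matrix.smul_mul]
  exact IsCriticalJet.mul hF hG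

theorem mul_contDiffAt (hF : HasJet k S F 0 α β p q) (hG : ContDiffAt ℝ 2 G 0) :
    HasJet k S (fun x => F x * G x) 0 (G 0 * α) (G 0 * β) (G 0 * p) (G 0 * q) := by
  rw [HasJet, ← smul_quadMatrix, Matrix.mul_smul, Matrix.smul_mul]
  exact IsCriticalJet.mul_contDiffAt hF hG

theorem sq_norm_fst (hS : IsCenteredAt k S) :
    HasJet k S (fun x => ‖(S x).val k.pos‖ ^ 2) 0 2 0 0 0 := by
  rw [HasJet]
  convert (hS.isCriticalJet_mul 0 0).add (hS.isCriticalJet_mul 1 1) using 1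
  · ext x
    rw [← Complex.normSq_eq_norm_sq, Complex.normSq_apply]
    rfl
  · simp
  · ext i j
    simp [Matrix.mul_apply, Fin.sum_univ_four, quadMatrix]
    ring

theorem sq_norm_snd (hS : IsCenteredAt k S) :
    HasJet k S (fun x => ‖(S x).val (k.pos + 1)‖ ^ 2) 0 0 2 0 0 := by
  rw [HasJet]
  convert (hS.isCriticalJet_mul 2 2).add (hS.isCriticalJet_mul 3 3) using 1
  · ext x
    rw [← Complex.normSq_eq_norm_sq, Complex.normSq_apply]
    rfl
  · simp
  · ext i j
    simp [Matrix.mul_apply, Fin.sum_univ_four, quadMatrix]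
    ring

theorem re_mul (hS : IsCenteredAt k S) :
    HasJet k S (fun x => ((S x).val k.pos * (S x).val (k.pos + 1)).re) 0 0 0 1 0 := by
  rw [HasJet]
  convert (hS.isCriticalJet_mul 0 2).add
    ((IsCriticalJet.const (-1)).mul (hS.isCriticalJet_mul 1 3)) using 1
  · ext x
    simp [freeCoord]
    ring
  · simp
  · ext i j
    simp [Matrix.mul_apply, Fin.sum_univ_four, quadMatrix]
    ring

/-- The sign comes from the convention in `quadMatrix`, under which `Re(c z_k z_{k+1})` has `p = Re
c` and `q = Im c`. -/
theorem im_mul (hS : IsCenteredAt k S) :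
    HasJet k S (fun x => ((S x).val k.pos * (S x).val (k.pos + 1)).im) 0 0 0 0 (-1) := by
  rw [HasJet]
  convert (hS.isCriticalJet_mul 0 3).add (hS.isCriticalJet_mul 1 2) using 1
  · ext x
    simp [freeCoord]
  · simp
  · ext i j
    simp [Matrix.mul_apply, Fin.sum_univ_four, quadMatrix]
    ring

theorem sq_norm (hS : IsCenteredAt k S) (i : Fin 8) :
    HasJet k S (fun x => ‖(S x).val i‖ ^ 2) (k.sq 0 0 i) (2 * (k.sq 1 0 i - k.sq 0 0 i))
      (2 * (k.sq 0 1 i - k.sq 0 0 i)) 0 0 := by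
  convert ((const (k.sq 0 0 i)).add ((sq_norm_fst hS).mul
    (const (k.sq 1 0 i - k.sq 0 0 i)))).add
      ((sq_norm_snd hS).mul (const (k.sq 0 1 i - k.sq 0 0 i))) using 1
  · ext x
    rw [sq_norm_eq k, sq_eq_affine]
  all_goals ring

end HasJet

/-! ### The monomial near an invariant point -/

/-- The monomial `conj (z₂ z₃ z₄) z₆ z₇ z₈`, or its conjugate, without the factors `z_k`
and `z_{k+1}`. -/
noncomputable def cofactor : Label → (Fin 8 → ℂ) → ℂ
  | .two, z => starRingEnd ℂ (starRingEnd ℂ (z 3) * z 5 * z 6 * z 7)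
  | .three, z => starRingEnd ℂ (starRingEnd ℂ (z 1) * z 5 * z 6 * z 7)
  | .six, z => starRingEnd ℂ (z 1 * z 2 * z 3) * z 7
  | .seven, z => starRingEnd ℂ (z 1 * z 2 * z 3) * z 5

theorem monomial_re (k : Label) (z : Fin 8 → ℂ) :
    (monomial z).re = (z k.pos * z (k.pos + 1)).re * (cofactor k z).re
      + -1 * ((z k.pos * z (k.pos + 1)).im * (cofactor k z).im) := by
  have e1 : (5 : Fin 8) + 1 = 6 := rfl
  have e2 : (6 : Fin 8) + 1 = 7 := rfl
  have e3 : (1 : Fin 8) + 1 = 2 := rfl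
  have e4 : (2 : Fin 8) + 1 = 3 := rfl
  cases k <;> simp only [monomial, cofactor, Label.pos, e1, e2, e3, e4] <;> simp <;> ring

/-- `|cofactor|²` at the invariant points. -/
theorem sq_norm_cofactor {k : Label} {S : (Fin 4 → ℝ) → LevelSet} (hS : IsCenteredAt k S) :
    (cofactor k (S 0).val).re ^ 2 + (cofactor k (S 0).val).im ^ 2 = 24 ^ 2 := by
  -- `S 0` is an arbitrary representative of its orbit, so only the moduli of its coordinates are
  -- known; they suffice here.
  have h := (fun i => (HasJet.sq_norm hS i).value)
  rw [sq, sq, ← Complex.normSq_apply, Complex.normSq_eq_norm_sq]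
  cases k <;> simp [cofactor, mul_pow, h, Label.sq] <;> norm_num

/-! ### The symplectic form at an invariant point -/

variable {k : Label} {S : (Fin 4 → ℝ) → LevelSet}

theorem IsCenteredAt.hasFDerivAt (hS : IsCenteredAt k S) :
    HasFDerivAt (fun x => (S x).val) (fderiv ℝ (fun x => (S x).val) 0) 0 :=
  (hS.contDiffAt.differentiableAt (by simp)).hasFDerivAt

theorem IsCenteredAt.jacobian_apply (hS : IsCenteredAt k S) (m i : Fin 4) :
    jacobian k S m i =
      freeCoord k (fderiv ℝ (fun x => (S x).val) 0 (Pi.single i 1)) m := by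
  have h (j : Fin 8) := hasFDerivAt_pi'.1 hS.hasFDerivAt j
  have hre (j : Fin 8) := (Complex.reCLM.hasFDerivAt.comp (0 : Fin 4 → ℝ) (h j)).fderiv
  have him (j : Fin 8) := (Complex.imCLM.hasFDerivAt.comp (0 : Fin 4 → ℝ) (h j)).fderiv
  fin_cases m
  · exact DFunLike.congr_fun (hre k.pos) _
  · exact DFunLike.congr_fun (him k.pos) _
  · exact DFunLike.congr_fun (hre (k.pos + 1)) _
  · exact DFunLike.congr_fun (him (k.pos + 1)) _

theorem sq_zero_pos (k : Label) (j : Fin 8) (h1 : j ≠ k.pos) (h2 : j ≠ k.pos + 1) :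
    0 < k.sq 0 0 j := by
  revert h1 h2
  cases k <;> fin_cases j <;> simp [Label.sq, Label.pos]

/-- `|z_j|²` is critical at the origin, so `z_j` can only move orthogonally to itself. -/
theorem IsCenteredAt.re_mul_add_im_mul (hS : IsCenteredAt k S) (j : Fin 8) (v : Fin 4 → ℝ) :
    ((S 0).val j).re * (fderiv ℝ (fun x => (S x).val) 0 v j).re
      + ((S 0).val j).im * (fderiv ℝ (fun x => (S x).val) 0 v j).im = 0 := by
  have h := hasFDerivAt_pi'.1 hS.hasFDerivAt j
  have hre := Complex.reCLM.hasFDerivAt.comp (0 : Fin 4 → ℝ) h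
  have him := Complex.imCLM.hasFDerivAt.comp (0 : Fin 4 → ℝ) h
  have h0 := (HasJet.sq_norm hS j).hasFDerivAt
  have h1 := (hre.mul hre).add (him.mul him)
  have h2 := h1.unique (h0.congr_of_eventuallyEq (Filter.Eventually.of_forall fun x => by
    simp [← Complex.normSq_eq_norm_sq, Complex.normSq_apply]))
  have h3 := DFunLike.congr_fun h2 v
  simp at h3
  linarith

/-- The coordinates other than `z_k` and `z_{k+1}` do not contribute to the symplectic form. -/
theorem IsCenteredAt.area_eq_zero (hS : IsCenteredAt k S) (j : Fin 8) (h1 : j ≠ k.pos)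
    (h2 : j ≠ k.pos + 1) (v w : Fin 4 → ℝ) :
    (fderiv ℝ (fun x => (S x).val) 0 v j).re * (fderiv ℝ (fun x => (S x).val) 0 w j).im
      - (fderiv ℝ (fun x => (S x).val) 0 v j).im
        * (fderiv ℝ (fun x => (S x).val) 0 w j).re = 0 := by
  have hv := hS.re_mul_add_im_mul j v
  have hw := hS.re_mul_add_im_mul j w
  have hpos := sq_zero_pos k j h1 h2
  rw [← (HasJet.sq_norm hS j).value, ← Complex.normSq_eq_norm_sq, Complex.normSq_apply] at hpos
  generalize (S 0).val j = z at *
  generalize fderiv ℝ (fun x => (S x).val) 0 v j = a at *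
  generalize fderiv ℝ (fun x => (S x).val) 0 w j = b at *
  refine (mul_eq_zero.1 ?_).resolve_left hpos.ne'
  -- Two vectors of the plane orthogonal to the same `z ≠ 0` are parallel; multiplied by `|z|²`,
  -- their area is this combination.
  linear_combination (z.re * b.im - z.im * b.re) * hv + (z.im * a.re - z.re * a.im) * hw

theorem IsCenteredAt.formMatrix_eq (hS : IsCenteredAt k S) :
    formMatrix S 0 = (jacobian k S).transpose * areaMatrix * jacobian k S := by
  ext i j
  have h := fun l h1 h2 => hS.area_eq_zero l h1 h2 (Pi.single i 1) (Pi.single j 1)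
  simp only [formMatrix, Matrix.of_apply, stdForm, Matrix.mul_apply, Fin.sum_univ_four,
    hS.jacobian_apply, Matrix.transpose_apply]
  rw [← Finset.sum_subset (Finset.subset_univ {k.pos, k.pos + 1}) fun l _ hl => h l
    (fun e => hl (by simp [e])) (fun e => hl (by simp [e])),
    Finset.sum_pair (by cases k <;> decide)]
  simp [freeCoord, areaMatrix]
  ring

/-- Moduli are constant on torus orbits, so the zeros of the standard representative are zeros of
every representative. -/
theorem IsLocalParametrization.isCenteredAt (hS : IsLocalParametrization S (invariantPoint k)) :
    IsCenteredAt k S := by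
  obtain ⟨h0, ⟨U, hU, h0U, hd⟩, -⟩ := hS
  have hr : torusSetoid.r (S 0) k.rep := Quotient.exact h0
  refine ⟨(hd.contDiffAt (hU.mem_nhds h0U)).of_le (WithTop.coe_le_coe.2 le_top), ?_, ?_⟩
  · rw [← norm_eq_zero, norm_val_eq hr, norm_eq_zero]
    cases k <;> simp [Label.rep, LevelSet.val, Label.vec, Label.pos]
  · rw [← norm_eq_zero, norm_val_eq hr, norm_eq_zero]
    cases k <;> simp [Label.rep, LevelSet.val, Label.vec, Label.pos]

/-! ### Jets of `J` and `H_t`, and the determinant -/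

theorem cofactor_contDiffAt (hS : IsCenteredAt k S) :
    ContDiffAt ℝ 2 (fun x => cofactor k (S x).val) 0 := by
  have h := hS.contDiffAt_apply
  have hc : ∀ {f : (Fin 4 → ℝ) → ℂ}, ContDiffAt ℝ 2 f 0 →
      ContDiffAt ℝ 2 (fun x => starRingEnd ℂ (f x)) 0 := fun hf =>
    Complex.conjCLE.contDiff.contDiffAt.comp 0 hf
  cases k
  · exact hc ((((hc (h 3)).mul (h 5)).mul (h 6)).mul (h 7))
  · exact hc ((((hc (h 1)).mul (h 5)).mul (h 6)).mul (h 7))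
  · exact (hc (((h 1).mul (h 2)).mul (h 3))).mul (h 7)
  · exact (hc (((h 1).mul (h 2)).mul (h 3))).mul (h 5)

theorem hasJet_monomial (hS : IsCenteredAt k S) :
    HasJet k S (fun x => (monomial (S x).val).re) 0 0 0 (cofactor k (S 0).val).re
      (cofactor k (S 0).val).im := by
  have hc := cofactor_contDiffAt hS
  have hre := Complex.reCLM.contDiff.contDiffAt.comp (0 : Fin 4 → ℝ) hc
  have him := Complex.imCLM.contDiff.contDiffAt.comp (0 : Fin 4 → ℝ) hc
  convert ((HasJet.re_mul hS).mul_contDiffAt hre).add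
    ((HasJet.const (-1)).mul ((HasJet.im_mul hS).mul_contDiffAt him)) using 1
  · ext x
    exact monomial_re k _
  all_goals simp

theorem hasJet_J (hS : IsCenteredAt k S) :
    HasJet k S (inCoords J S) (k.sq 0 0 0 / 2) (k.sq 1 0 0 - k.sq 0 0 0)
      (k.sq 0 1 0 - k.sq 0 0 0) 0 0 := by
  convert (HasJet.const (1 / 2)).mul (HasJet.sq_norm hS 0) using 1
  · ext x
    simp [inCoords, J, absCoord, toM]
    ring
  all_goals ring

/-- The second derivative of `H_t` in the direction `z_k` (with `s = k.sq 1 0`) or `z_{k+1}`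
(with `s = k.sq 0 1`), in terms of the squared moduli `r = k.sq 0 0` at the invariant point. -/
noncomputable def HtCoeff (t : Fin 4 → ℝ) (r s : Fin 8 → ℝ) : ℝ :=
  (1 - 2 * t 0) * (s 2 - r 2)
    + t 1 / 50 * (4 * (r 4 * r 3) * (r 4 * (s 3 - r 3) + r 3 * (s 4 - r 4)))
    + t 2 / 50 * (4 * (r 3 * r 6) * (r 3 * (s 6 - r 6) + r 6 * (s 3 - r 3)))
    + t 3 / 100 * (4 * (r 4 * r 6) * (r 4 * (s 6 - r 6) + r 6 * (s 4 - r 4)))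

theorem hasJet_Ht (hS : IsCenteredAt k S) (t : Fin 4 → ℝ) :
    HasJet k S (inCoords (Ht t) S) (inCoords (Ht t) S 0) (HtCoeff t (k.sq 0 0) (k.sq 1 0))
      (HtCoeff t (k.sq 0 0) (k.sq 0 1)) (t 0 / 50 * (cofactor k (S 0).val).re)
      (t 0 / 50 * (cofactor k (S 0).val).im) := by
  have h := HasJet.sq_norm hS
  -- `|z_i|⁴|z_j|⁴` is the square of `|z_i|²|z_j|²`, which keeps everything within products of known
  -- jets.
  have hp (i j : Fin 8) := (((h i).mul (h j)).mul ((h i).mul (h j)))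
  have key := (((((HasJet.const ((1 - 2 * t 0) / 2)).mul (h 2)).add
    ((HasJet.const (t 0 / 50)).mul (hasJet_monomial hS))).add
    ((HasJet.const (t 1 / 50)).mul (hp 4 3))).add
    ((HasJet.const (t 2 / 50)).mul (hp 3 6))).add
    ((HasJet.const (t 3 / 100)).mul (hp 4 6))
  have hF := key.value
  convert key using 1
  · ext x
    simp [inCoords, Ht, H, γ₁, γ₂, γ₃, γ₄, absCoord, toM]
    ring
  · rw [← hF]
    simp [inCoords, Ht, H, γ₁, γ₂, γ₃, γ₄, absCoord, toM]
    ring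
  · simp only [HtCoeff]
    ring
  · simp only [HtCoeff]
    ring
  all_goals ring

/-- After cancelling the Jacobian, what remains is `(αβ - (p² + q²))²`, and `f_k / 625` equals `p² +
q² - αβ`; note `625² = 390625`. -/
theorem linearization_det (hS : IsCenteredAt k S) (hU : IsUnit (formMatrix S 0).det)
    (t : Fin 4 → ℝ) (c₁ c₂ : ℝ) :
    (linearization J (Ht t) S c₁ c₂).det =
      (k.poly (t 0) (t 1) (t 2) (t 3) c₁ c₂) ^ 2 / 390625 := by
  have hH := hasJet_Ht hS t
  have e1 : hessian J S = _ := (hasJet_J hS).hess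
  have e2 : hessian (Ht t) S = _ := hH.hess
  rw [hS.formMatrix_eq] at hU
  rw [linearization, e1, e2, hS.formMatrix_eq, ← Matrix.smul_mul c₁, ← Matrix.smul_mul c₂,
    ← Matrix.mul_smul _ c₁, ← Matrix.mul_smul _ c₂, ← Matrix.add_mul, ← Matrix.mul_add, smul_quadMatrix,
    smul_quadMatrix, quadMatrix_add, det_inv_congruence_mul _ _ _ det_areaMatrix hU,
    det_quadMatrix]
  have hc := sq_norm_cofactor hS
  -- Only the modulus of the cofactor enters, so its unknown phase is harmless.
  have : ∀ a b : ℝ, (c₁ * 0 + c₂ * (t 0 / 50 * a)) ^ 2 + (c₁ * 0 + c₂ * (t 0 / 50 * b)) ^ 2 =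
    (c₂ * (t 0 / 50)) ^ 2 * (a ^ 2 + b ^ 2) := fun a b => by ring
  rw [this, hc]
  cases k <;> simp [HtCoeff, Label.sq, Label.poly] <;> ring

/-! ### The charts are local parametrizations -/

theorem chartDomain_zero_mem (k : Label) : (0 : Fin 4 → ℝ) ∈ chartDomain k := fun i h1 h2 => by
  simpa using sq_zero_pos k i h1 h2

theorem contDiff_sq (k : Label) (i : Fin 8) : ContDiff ℝ ((⊤ : ℕ∞) : WithTop ℕ∞)
    (fun x : Fin 4 → ℝ => k.sq (x 0 ^ 2 + x 1 ^ 2) (x 2 ^ 2 + x 3 ^ 2) i) := by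
  simp only [fun x : Fin 4 → ℝ => sq_eq_affine k (x 0 ^ 2 + x 1 ^ 2) (x 2 ^ 2 + x 3 ^ 2) i]
  fun_prop

theorem isOpen_chartDomain (k : Label) : IsOpen (chartDomain k) := by
  simp only [chartDomain, Set.ofPred_forall]
  exact isOpen_iInter_of_finite fun i => isOpen_iInter_of_finite fun _ =>
    isOpen_iInter_of_finite fun _ => isOpen_lt continuous_const (contDiff_sq k i).continuous

theorem chart_val {x : Fin 4 → ℝ} (hx : x ∈ chartDomain k) :
    (chart k x).val = chartVec k x := by
  have : chart k x = ⟨chartVec k x, chartVec_mem k x hx⟩ := dif_pos hx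
  rw [this]
  rfl

theorem chartVec_contDiffOn (k : Label) :
    ContDiffOn ℝ ((⊤ : ℕ∞) : WithTop ℕ∞) (chartVec k) (chartDomain k) := by
  have hmk (m n : Fin 4) : ContDiff ℝ ((⊤ : ℕ∞) : WithTop ℕ∞)
      (fun x : Fin 4 → ℝ => (⟨x m, x n⟩ : ℂ)) := by
    have : (fun x : Fin 4 → ℝ => (⟨x m, x n⟩ : ℂ)) =
        fun x => Complex.ofRealCLM (x m) + Complex.ofRealCLM (x n) * Complex.I := by
      ext x
      exact Complex.mk_eq_add_mul_I _ _
    rw [this]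
    fun_prop
  refine contDiffOn_pi.2 fun i => ?_
  unfold chartVec
  split_ifs with h1 h2
  · exact (hmk 0 1).contDiffOn
  · exact (hmk 2 3).contDiffOn
  · exact Complex.ofRealCLM.contDiff.comp_contDiffOn
      ((contDiff_sq k i).contDiffOn.sqrt fun x hx => (hx i h1 h2).ne')

theorem chart_contDiffOn (k : Label) :
    ContDiffOn ℝ ((⊤ : ℕ∞) : WithTop ℕ∞) (fun x => (chart k x).val) (chartDomain k) :=
  (chartVec_contDiffOn k).congr fun _ hx => chart_val hx

theorem freeCoord_chartVec (k : Label) (x : Fin 4 → ℝ) (m : Fin 4) :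
    freeCoord k (chartVec k x) m = x m := by
  have : k.pos + 1 ≠ k.pos := by cases k <;> decide
  fin_cases m <;> simp [freeCoord, chartVec]

theorem isCenteredAt_chart (k : Label) : IsCenteredAt k (chart k) := by
  have h0 := chart_val (chartDomain_zero_mem k)
  refine ⟨((chart_contDiffOn k).contDiffAt
    ((isOpen_chartDomain k).mem_nhds (chartDomain_zero_mem k))).of_le
      (WithTop.coe_le_coe.2 le_top), ?_, ?_⟩
  · simp [h0, chartVec, Complex.ext_iff]
  · simp [h0, chartVec, Complex.ext_iff]

theorem jacobian_chart (k : Label) : jacobian k (chart k) = 1 := by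
  ext m i
  have h : (fun x => freeCoord k (chart k x).val m) =ᶠ[nhds 0] fun x => x m := by
    filter_upwards [(isOpen_chartDomain k).mem_nhds (chartDomain_zero_mem k)] with x hx
    rw [chart_val hx, freeCoord_chartVec]
  simp only [jacobian, Matrix.of_apply, h.fderiv_eq]
  rw [(hasFDerivAt_apply m (0 : Fin 4 → ℝ)).fderiv]
  simp [Matrix.one_apply, Pi.single_apply]

theorem toM_chart_zero (k : Label) : toM (chart k 0) = invariantPoint k := by
  have h8 : √(8 : ℝ) = 2 * √2 := by
    rw [show (8 : ℝ) = 2 ^ 2 * 2 by norm_num, Real.sqrt_mul (by norm_num),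
      Real.sqrt_sq (by norm_num)]
  have h4 : √(4 : ℝ) = 2 := by
    rw [show (4 : ℝ) = 2 ^ 2 by norm_num, Real.sqrt_sq (by norm_num)]
  have : chart k 0 = k.rep := Subtype.ext <| by
    change (chart k 0).val = k.vec
    rw [chart_val (chartDomain_zero_mem k)]
    ext i
    cases k <;> fin_cases i <;>
      simp [chartVec, Label.vec, Label.pos, Label.sq, Complex.ext_iff, h8, h4]
  rw [this, invariantPoint]

theorem isLocalParametrization_chart (k : Label) :
    IsLocalParametrization (chart k) (invariantPoint k) := by
  refine ⟨toM_chart_zero k, ⟨_, isOpen_chartDomain k, chartDomain_zero_mem k,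
    chart_contDiffOn k⟩, ?_⟩
  rw [(isCenteredAt_chart k).formMatrix_eq, jacobian_chart]
  simp [det_areaMatrix]

/-! ### Hessians of functions commuting with the normal form -/

/-- If `x_m ∂_n F = x_m' ∂_n' F` near a critical point of `F` at the origin, then the Hessian
satisfies the corresponding identity. -/
theorem secondDeriv_relation {F : (Fin 4 → ℝ) → ℝ} {c : ℝ} {h : Matrix (Fin 4) (Fin 4) ℝ}
    (hF : IsCriticalJet F c h) {m n m' n' : Fin 4}
    (hx : ∀ᶠ x in nhds (0 : Fin 4 → ℝ),
      x m * fderiv ℝ F x (Pi.single n 1) = x m' * fderiv ℝ F x (Pi.single n' 1))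
    (v : Fin 4 → ℝ) :
    v m * ∑ i, v i * h i n = v m' * ∑ i, v i * h i n' := by
  have hd (j : Fin 4) : HasDerivAt (fun s : ℝ => fderiv ℝ F (s • v) (Pi.single j 1))
      (∑ i, v i * h i j) 0 := by
    have h1 := (differentiableAt_fderiv_apply hF.contDiffAt (Pi.single j 1)).hasFDerivAt
    have h2 : HasDerivAt (fun s : ℝ => s • v) v 0 := by
      simpa using (hasDerivAt_id (0 : ℝ)).smul_const v
    rw [← zero_smul ℝ v] at h1
    refine (h1.comp_hasDerivAt (0 : ℝ) h2).congr_deriv ?_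
    rw [zero_smul]
    conv_lhs => rw [pi_eq_sum_univ' v]
    rw [map_sum]
    refine Finset.sum_congr rfl fun i _ => ?_
    rw [map_smul, ← hF.hess]
    rfl
  have hs : Filter.Tendsto (fun s : ℝ => s • v) (nhds 0) (nhds 0) := by
    have : Continuous fun s : ℝ => s • v := by fun_prop
    simpa using this.tendsto 0
  -- Along the ray `s • v` the relation carries a factor `s`, which cancels for `s ≠ 0`; at `s = 0`
  -- both sides vanish by criticality. Differentiating at `s = 0` then gives the claim.
  have he : (fun s : ℝ => v m * fderiv ℝ F (s • v) (Pi.single n 1)) =ᶠ[nhds 0]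
      fun s => v m' * fderiv ℝ F (s • v) (Pi.single n' 1) := by
    filter_upwards [hs.eventually hx] with s hs
    rcases eq_or_ne s 0 with rfl | h0
    · simp [hF.fderiv_eq]
    · refine mul_left_cancel₀ h0 ?_
      simpa [mul_assoc] using hs
  exact (((hd n).const_mul (v m)).congr_of_eventuallyEq he.symm).unique ((hd n').const_mul (v m'))

/-- Invariance of the quadratic part under both normal-form flows forces it to be a combination `a
q₁ + b q₂`, whose Hessian has determinant `-(ab)²`. -/
theorem det_nonpos_of_poisson {F : (Fin 4 → ℝ) → ℝ} {c : ℝ} {h : Matrix (Fin 4) (Fin 4) ℝ}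
    (hF : IsCriticalJet F c h)
    (hE : ∀ᶠ x in nhds (0 : Fin 4 → ℝ), poisson (fun y => (y 0 ^ 2 + y 2 ^ 2) / 2) F x = 0)
    (hH : ∀ᶠ x in nhds (0 : Fin 4 → ℝ), poisson (fun y => y 1 * y 3) F x = 0) :
    h.det ≤ 0 := by
  have d (i : Fin 4) (x : Fin 4 → ℝ) := hasFDerivAt_apply (𝕜 := ℝ) i x
  have eE := secondDeriv_relation hF (m := 0) (n := 2) (m' := 2) (n' := 0) <| by
    filter_upwards [hE] with x hx
    have h1 := ((((d 0 x).pow 2).add ((d 2 x).pow 2)).mul_const (2⁻¹ : ℝ)).fderiv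
    have h2 : (fun y : Fin 4 → ℝ => (y 0 ^ 2 + y 2 ^ 2) / 2) =
      fun y => (y 0 ^ 2 + y 2 ^ 2) * 2⁻¹ := by ext; ring
    simp only [poisson, h2] at hx
    erw [h1] at hx
    simp at hx
    linarith
  have eH := secondDeriv_relation hF (m := 3) (n := 3) (m' := 1) (n' := 1) <| by
    filter_upwards [hH] with x hx
    have h1 := ((d 1 x).mul (d 3 x)).fderiv
    simp only [poisson] at hx
    erw [h1] at hx
    simp at hx
    linarith
  simp only [Fin.sum_univ_four] at eE eH
  -- Polarization: basis vectors and sums of two of them isolate the entries. What survives is `h 0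
  -- 0 = h 2 2` and `h 1 3 = h 3 1`.
  have a1 := eE ![1, 0, 0, 0]
  have a2 := eE ![0, 0, 1, 0]
  have a3 := eE ![1, 0, 1, 0]
  have a4 := eE ![1, 1, 0, 0]
  have a5 := eE ![1, 0, 0, 1]
  have a6 := eE ![0, 1, 1, 0]
  have a7 := eE ![0, 0, 1, 1]
  have b1 := eH ![0, 1, 0, 0]
  have b2 := eH ![0, 0, 0, 1]
  have b3 := eH ![0, 1, 0, 1]
  have b4 := eH ![1, 1, 0, 0]
  have b5 := eH ![1, 0, 0, 1]
  have b6 := eH ![0, 1, 1, 0]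
  have b7 := eH ![0, 0, 1, 1]
  simp at a1 a2 a3 a4 a5 a6 a7 b1 b2 b3 b4 b5 b6 b7
  simp [a1, ← a2] at a3 a4 a5 a6 a7
  simp [← b1, b2] at b3 b4 b5 b6 b7
  have : h.det = -(h 0 0 * h 1 3) ^ 2 := by
    simp [Matrix.det_succ_row_zero, Fin.sum_univ_succ, Fin.succAbove, ← a2, a3, a4, a5, ← a6,
      ← a7, ← b1, b2, b3, ← b6, b7]
    ring
  rw [this]
  nlinarith [sq_nonneg (h 0 0 * h 1 3)]

end Octagon

/-! ### The main theorem -/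

theorem mainTheorem8 (k : Octagon.Label) (t : Fin 4 → ℝ) :
    Octagon.IsLocalParametrization (Octagon.chart k) (Octagon.invariantPoint k) ∧
    Octagon.IsFixedPoint Octagon.J (Octagon.Ht t) (Octagon.invariantPoint k) ∧
    (∀ S, Octagon.IsLocalParametrization S (Octagon.invariantPoint k) → ∀ c₁ c₂ : ℝ,
      (Octagon.linearization Octagon.J (Octagon.Ht t) S c₁ c₂).det =
        (k.poly (t 0) (t 1) (t 2) (t 3) c₁ c₂) ^ 2 / 390625) ∧
    ¬ Octagon.IsHyperbolicElliptic Octagon.J (Octagon.Ht t) (Octagon.invariantPoint k) ∧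
    ¬ Octagon.HasHyperbolicEllipticNormalForm Octagon.J (Octagon.Ht t)
      (Octagon.invariantPoint k) := by
  open Octagon in
  refine ⟨isLocalParametrization_chart k, fun S hS => ?_, fun S hS c₁ c₂ => ?_, ?_, ?_⟩
  · exact ⟨(hasJet_J hS.isCenteredAt).hasFDerivAt, (hasJet_Ht hS.isCenteredAt t).hasFDerivAt⟩
  · exact linearization_det hS.isCenteredAt hS.2.2 t c₁ c₂
  · rintro ⟨-, S, hS, c₁, c₂, α, β, hα, hβ, h⟩
    have h1 := det_neg_of_spectrum _ hα hβ h
    rw [linearization_det hS.isCenteredAt hS.2.2] at h1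
    exact h1.not_ge (by positivity)
  · rintro ⟨-, S, hS, h⟩
    -- `J` alone gives the contradiction: taking `c₁ = 1`, `c₂ = 0` makes `f_k = 625` for every `t`,
    -- so its Hessian in canonical coordinates has determinant 1.
    have hJ := hasJet_J hS.isCenteredAt
    have h1 : (hessian J S).det ≤ 0 := by
      rw [show hessian J S = _ from hJ.hess]
      exact det_nonpos_of_poisson hJ (h.mono fun x hx => (hx.2 J (by simp)).1)
        (h.mono fun x hx => (hx.2 J (by simp)).2)
    have h2 := linearization_det hS.isCenteredAt hS.2.2 t 1 0
    rw [linearization, h.self_of_nhds.1, Matrix.det_mul, Matrix.det_nonsing_inv,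
      det_canonicalForm] at h2
    have h3 : k.poly (t 0) (t 1) (t 2) (t 3) 1 0 = 625 := by cases k <;> simp [Label.poly]
    rw [h3] at h2
    simp at h2
    norm_num at h2
    linarith
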